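/- A *distribution* is a linear functional on $\mathbb{C}[x]$. For a unital complex algebra $B$, a linear functional $\varphi$ on $B$ and $b\in B$, the distribution of $b$ with respect to $\varphi$ is $x^n\mapsto\varphi(b^n)$, $n\ge 0$. *Free convolution.* Let $\varphi:B\to\mathbb{C}$ be linear with $\varphi(1)=1$. Elements $b_1,b_2\in B$ are free if $\varphi(c_1\cdots c_n)=0$ whenever $n\ge1$, $i_1,\dots,i_n\in\{1,2\}$ with $i_k\ne i_{k+1}$ for $1\le k<n$, each $c_k$ lies in the unital subalgebra generated by $b_{i_k}$, and $\varphi(c_k)=0$ for all $k$. If $b_1,b_2$ are free with distributions $\mu_1,\mu_2$ with respect to $\varphi$, the distribution of $b_1+b_2$ is called the free convolution $\mu_1\boxplus\mu_2$. *Infinitesimal free convolution.* Let in addition $\varphi':B\to\mathbb{C}$ be linear with $\varphi'(1)=0$. The elements $b_1,b_2$ are infinitesimally free with respect to $(\varphi,\varphi')$ if, for all $c_1,\dots,c_n$ as above, $\varphi(c_1\cdots c_n)=0$, and $$\varphi'(c_1\cdots c_n)=\varphi(c_1c_n)\,\varphi(c_2c_{n-1})\cdots\varphi(c_{(n-1)/2}c_{(n+3)/2})\,\varphi'(c_{(n+1)/2})$$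 if $n$ is odd and $i_k=i_{n+1-k}$ for all $k$, and $\varphi'(c_1\cdots c_n)=0$ otherwise. The infinitesimal distribution of $b\in B$ is the pair of its distributions with respect to $\varphi$ and $\varphi'$. If $b_1,b_2$ are infinitesimally free with infinitesimal distributions $(\mu_1,\nu_1),(\mu_2,\nu_2)$, the infinitesimal distribution of $b_1+b_2$ is called the infinitesimal free convolution $(\mu_1,\nu_1)\boxplus(\mu_2,\nu_2)$. *Inverse Markov–Krein transform.* For a distribution $\mu$ put $G_\mu(z)=\sum_{n\ge0}\mu(x^n)z^{-n-1}$, a formal series in $1/z$. If $\mu(1)=1$, the inverse Markov–Krein transform of $\mu$ is the unique distribution $\tau$ with $\frac{d}{dz}G_\mu(z)=-G_\tau(z)G_\mu(z)$. **Proposition.** Let $\mu_1,\mu_2$ be distributions with $\mu_1(1)=\mu_2(1)=1$. Then the free convolution $\mu:=\mu_1\boxplus\mu_2$ is well defined: it exists and is unique. Let $\tau_1,\tau_2,\tau$ be the inverse Markov–Krein transforms of $\mu_1,\mu_2,\mu$. Then the infinitesimal free convolution of $(\mu_1,\mu_1-\tau_1)$ and $(\mu_2,\mu_2-\tau_2)$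 is also well defined, and $$(\mu_1,\mu_1-\tau_1)\boxplus(\mu_2,\mu_2-\tau_2)=(\mu,\mu-\tau).$$ -/

import Mathlib

universe u

namespace FreeProb

/-- A distribution: a linear functional on `ℂ[x]`. -/
abbrev Distribution : Type := Polynomial ℂ →ₗ[ℂ] ℂ

/-- The distribution of `b` with respect to a linear functional `φ`, i.e. `xⁿ ↦ φ (bⁿ)`. -/
noncomputable def distribution {B : Type*} [Ring B] [Algebra ℂ B] (φ : B →ₗ[ℂ] ℂ) (b : B) :
    Distribution :=
  φ ∘ₗ (Polynomial.aeval b).toLinearMap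

theorem distribution_X_pow {B : Type*} [Ring B] [Algebra ℂ B] (φ : B →ₗ[ℂ] ℂ) (b : B) (n : ℕ) :
    distribution φ b (Polynomial.X ^ n) = φ (b ^ n) := by
  simp [distribution]

/-- `(i 0, i 1, …, i (n-1))` is an alternating sequence: neighbouring indices differ. (Sequences of
length `n` are written as functions on `ℕ`, of which only the first `n` values matter.) -/
def Alternating {ι : Type*} (n : ℕ) (i : ℕ → ι) : Prop :=
  ∀ k, k + 1 < n → i k ≠ i (k + 1)

/-- `(b 0, …, b (n-1))` is a sequence of `φ`-centered elements, `b k` being taken from `S (i k)`. -/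
def CenteredIn {B : Type*} [Ring B] [Algebra ℂ B] {ι : Type*} (φ : B →ₗ[ℂ] ℂ)
    (S : ι → Subalgebra ℂ B) (n : ℕ) (i : ℕ → ι) (b : ℕ → B) : Prop :=
  ∀ k, k < n → b k ∈ S (i k) ∧ φ (b k) = 0

/-- The ordered product `b 0 * b 1 * ⋯ * b (n-1)`. -/
def orderedProd {B : Type*} [Ring B] (n : ℕ) (b : ℕ → B) : B :=
  ((List.range n).map b).prod

/-- Free independence of a family of unital subalgebras: the functional `φ` vanishes on every
nonempty alternating product of centered elements. -/
def FreelyIndependent {B : Type*} [Ring B] [Algebra ℂ B] {ι : Type*} (φ : B →ₗ[ℂ] ℂ)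
    (S : ι → Subalgebra ℂ B) : Prop :=
  ∀ (n : ℕ) (i : ℕ → ι) (b : ℕ → B), 0 < n → Alternating n i → CenteredIn φ S n i b →
    φ (orderedProd n b) = 0

open Classical in
/-- Infinitesimal freeness of a family of unital subalgebras with respect to `(φ, φ')`. For a
nonempty alternating product of `n` centered elements (numbered from `0` to `n - 1`), `φ` vanishes,
and `φ'` is `φ(b₀ bₙ₋₁) φ(b₁ bₙ₋₂) ⋯ φ'(middle element)` if `n` is odd and the index sequence is a
palindrome, and `0` otherwise. -/
def InfinitesimallyFree {B : Type*} [Ring B] [Algebra ℂ B] {ι : Type*} (φ φ' : B →ₗ[ℂ] ℂ)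
    (S : ι → Subalgebra ℂ B) : Prop :=
  ∀ (n : ℕ) (i : ℕ → ι) (b : ℕ → B), 0 < n → Alternating n i → CenteredIn φ S n i b →
    φ (orderedProd n b) = 0 ∧
    φ' (orderedProd n b) =
      if Odd n ∧ ∀ k, k < n / 2 → i k = i (n - 1 - k) then
        (∏ k ∈ Finset.range (n / 2), φ (b k * b (n - 1 - k))) * φ' (b (n / 2))
      else 0

/-- `μ` is the free convolution `μ₁ ⊞ μ₂`: it is the distribution of `b₁ + b₂` for some free
elements `b₁, b₂`, with distributions `μ₁, μ₂`, of a noncommutative probability space `(B, φ)`.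
Freeness of elements is freeness of the unital subalgebras which they generate. -/
def IsFreeConvolution (μ₁ μ₂ μ : Distribution) : Prop :=
  ∃ (B : Type u) (_ : Ring B) (_ : Algebra ℂ B) (φ : B →ₗ[ℂ] ℂ) (b₁ b₂ : B),
    φ 1 = 1 ∧
    FreelyIndependent φ ![Algebra.adjoin ℂ {b₁}, Algebra.adjoin ℂ {b₂}] ∧
    distribution φ b₁ = μ₁ ∧ distribution φ b₂ = μ₂ ∧ distribution φ (b₁ + b₂) = μ

/-- The pair `p` is the infinitesimal free convolution `p₁ ⊞ p₂`: it is the infinitesimal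
distribution of `b₁ + b₂` for some infinitesimally free elements `b₁, b₂`, with infinitesimal
distributions `p₁, p₂`, of an infinitesimal noncommutative probability space `(B, φ, φ')`. -/
def IsInfinitesimalFreeConvolution (p₁ p₂ p : Distribution × Distribution) : Prop :=
  ∃ (B : Type u) (_ : Ring B) (_ : Algebra ℂ B) (φ φ' : B →ₗ[ℂ] ℂ) (b₁ b₂ : B),
    φ 1 = 1 ∧ φ' 1 = 0 ∧
    InfinitesimallyFree φ φ' ![Algebra.adjoin ℂ {b₁}, Algebra.adjoin ℂ {b₂}] ∧
    (distribution φ b₁, distribution φ' b₁) = p₁ ∧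
    (distribution φ b₂, distribution φ' b₂) = p₂ ∧
    (distribution φ (b₁ + b₂), distribution φ' (b₁ + b₂)) = p

/-- The Cauchy transform `G_μ(z) = ∑ₙ μ(xⁿ) / z^(n+1)`, as a formal power series in `w = 1/z`. -/
noncomputable def cauchyTransform (μ : Distribution) : PowerSeries ℂ :=
  PowerSeries.X * PowerSeries.mk fun n => μ (Polynomial.X ^ n)

/-- The formal derivative `d/dz` of a power series in `w = 1/z`, namely `-w² d/dw`. -/
noncomputable def zDeriv (f : PowerSeries ℂ) : PowerSeries ℂ :=
  -(PowerSeries.X ^ 2 * PowerSeries.derivative ℂ f)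

/-- `τ` is the inverse Markov–Krein transform of `μ`: `d/dz G_μ(z) = - G_τ(z) G_μ(z)`. -/
def IsInverseMarkovKrein (μ τ : Distribution) : Prop :=
  zDeriv (cauchyTransform μ) = -(cauchyTransform τ * cauchyTransform μ)

/-- The inverse Markov–Krein transform is well defined. -/
theorem existsUnique_isInverseMarkovKrein (μ : Distribution) (hμ : μ 1 = 1) :
    ∃! τ : Distribution, IsInverseMarkovKrein μ τ := by
  set M : PowerSeries ℂ := PowerSeries.mk fun n => μ (Polynomial.X ^ n) with hM
  have hX : (PowerSeries.X : PowerSeries ℂ) ≠ 0 := PowerSeries.X_ne_zero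
  have hc : PowerSeries.constantCoeff M ≠ 0 := by
    simp [hM, hμ, ← PowerSeries.coeff_zero_eq_constantCoeff_apply]
  have hM0 : M ≠ 0 := by
    intro h
    simp [h] at hc
  have key : ∀ τ : Distribution, IsInverseMarkovKrein μ τ ↔
      (PowerSeries.mk fun n => τ (Polynomial.X ^ n)) * M =
        PowerSeries.derivative ℂ (PowerSeries.X * M) := by
    intro τ
    unfold IsInverseMarkovKrein zDeriv cauchyTransform
    rw [neg_inj, ← hM]
    constructor
    · intro h
      apply mul_left_cancel₀ (pow_ne_zero 2 hX)
      rw [h]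
      ring
    · intro h
      rw [← h]
      ring
  set T : PowerSeries ℂ := PowerSeries.derivative ℂ (PowerSeries.X * M) * M⁻¹ with hT
  refine ⟨(Polynomial.basisMonomials ℂ).constr ℂ fun n => PowerSeries.coeff n T, ?_, ?_⟩
  · have : (PowerSeries.mk fun n => ((Polynomial.basisMonomials ℂ).constr ℂ
        fun n => PowerSeries.coeff n T) (Polynomial.X ^ n)) = T := by
      ext n
      rw [PowerSeries.coeff_mk, Polynomial.X_pow_eq_monomial]
      have := (Polynomial.basisMonomials ℂ).constr_basis ℂ (fun n => PowerSeries.coeff n T) n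
      simpa [Polynomial.coe_basisMonomials] using this
    simp only [key]
    rw [this, hT, mul_assoc, PowerSeries.inv_mul_cancel _ hc, mul_one]
  · intro τ hτ
    rw [key] at hτ
    have h2 : (PowerSeries.mk fun n => τ (Polynomial.X ^ n)) = T := by
      rw [hT, ← hτ, mul_assoc, PowerSeries.mul_inv_cancel _ hc, mul_one]
    apply (Polynomial.basisMonomials ℂ).ext
    intro n
    rw [Module.Basis.constr_basis, ← h2, PowerSeries.coeff_mk, Polynomial.coe_basisMonomials,
      Polynomial.X_pow_eq_monomial]

end FreeProb

namespace FreeProb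

open Finset

/-! Existence comes from Voiculescu's full Fock space model, with the free algebra as Fock space and
dual numbers carrying the infinitesimal structure. For a letter `i` let `ℓ` be its creation operator
and `L` the removal of a leading `i`. The variable is `ℓ + ∑ κₖ Lᵏ - ε ℓ`; the constant and `ε`
parts of its vacuum moments give `φ` and `φ'`. The moment of order `n + 1` is `κ n` plus a function
of the earlier `κ`, so every normalized distribution occurs (`exists_distribution_fockVariable_eq`).
Three facts carry the proof. Variables at different letters are infinitesimally free: a centered
element turns a word not starting with its letter into words that do, and `φ'` obeys a Leibniz rule
(`infinitesimallyFree_fockSubalgebra`). The sum of two such variables acts on powers of the sum of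
the two letters as a single variable with parameter `κ + κ'`, including its `ε` part
(`distribution_fockVariable_add`). Finally, the `ε` part of the one-letter law is `μ - τ`; this is
the vacuum component of a vector identity for `bⁿ Ω` and its perturbation (`sum_fockVector'`).
Together they realize the required convolution. Uniqueness holds because alternating centered
products, together with `1`, span a space containing all powers of the sum, and (infinitesimal)
freeness prescribes the functionals on them. -/

theorem distribution_ext {μ ν : Distribution}
    (h : ∀ n, μ (Polynomial.X ^ n) = ν (Polynomial.X ^ n)) : μ = ν := by
  refine (Polynomial.basisMonomials ℂ).ext fun n => ?_
  simpa [Polynomial.coe_basisMonomials, Polynomial.X_pow_eq_monomial] using h n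

/-! ### Operators on the full Fock space -/

section Toeplitz

variable {ι : Type*}

theorem freeAlgebra_induction_left {p : FreeAlgebra ℂ ι → Prop} (one : p 1)
    (add : ∀ f g, p f → p g → p (f + g)) (smul : ∀ (c : ℂ) f, p f → p (c • f))
    (mul : ∀ a f, p f → p (FreeAlgebra.ι ℂ a * f)) (f : FreeAlgebra ℂ ι) : p f := by
  -- The extra right factor `g` lets the product case be handled by associativity.
  suffices h : ∀ f g : FreeAlgebra ℂ ι, p g → p (f * g) by simpa using h f 1 one
  intro f
  induction f using FreeAlgebra.induction with
  | grade0 r => intro g hg; rw [← Algebra.smul_def]; exact smul r g hg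
  | grade1 a => exact fun g hg => mul a g hg
  | mul a b ha hb => intro g hg; rw [mul_assoc]; exact ha _ (hb _ hg)
  | add a b ha hb => intro g hg; rw [add_mul]; exact add _ _ (ha _ hg) (hb _ hg)

/-- The augmentation of the free algebra, which reads off the coefficient of the empty word. -/
noncomputable def vacuum (ι : Type*) : FreeAlgebra ℂ ι →ₐ[ℂ] ℂ :=
  FreeAlgebra.lift ℂ fun _ => 0

@[simp] theorem vacuum_ι (a : ι) : vacuum ι (FreeAlgebra.ι ℂ a) = 0 := by
  simp [vacuum]

theorem vacuum_lift (s : FreeAlgebra ℂ ι) (hs : vacuum ι s = 0) (f : FreeAlgebra ℂ Unit) :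
    vacuum ι (FreeAlgebra.lift ℂ (fun _ : Unit => s) f) = vacuum Unit f := by
  have : (vacuum ι).comp (FreeAlgebra.lift ℂ (fun _ : Unit => s)) = vacuum Unit := by
    ext; simp [hs]
  exact DFunLike.congr_fun this f

/-- Left multiplication by a letter: the creation operator of the full Fock space. -/
noncomputable def creation (i : ι) : Module.End ℂ (FreeAlgebra ℂ ι) :=
  LinearMap.mulLeft ℂ (FreeAlgebra.ι ℂ i)

@[simp] theorem creation_apply (i : ι) (f : FreeAlgebra ℂ ι) :
    creation i f = FreeAlgebra.ι ℂ i * f := rfl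

variable (ι) in
/-- The vacuum state on operators on the Fock space, extended to dual numbers: the constant part. -/
noncomputable def vacuumState :
    DualNumber (Module.End ℂ (FreeAlgebra ℂ ι)) →ₗ[ℂ] ℂ :=
  (vacuum ι).toLinearMap ∘ₗ LinearMap.applyₗ (1 : FreeAlgebra ℂ ι) ∘ₗ
    (TrivSqZeroExt.fstHom ℂ (Module.End ℂ (FreeAlgebra ℂ ι))
      (Module.End ℂ (FreeAlgebra ℂ ι))).toLinearMap

variable (ι) in
/-- The vacuum state on operators on the Fock space, extended to dual numbers: the
infinitesimal part. -/
noncomputable def vacuumState' :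
    DualNumber (Module.End ℂ (FreeAlgebra ℂ ι)) →ₗ[ℂ] ℂ :=
  (vacuum ι).toLinearMap ∘ₗ LinearMap.applyₗ (1 : FreeAlgebra ℂ ι) ∘ₗ
    (TrivSqZeroExt.sndHom (Module.End ℂ (FreeAlgebra ℂ ι))
      (Module.End ℂ (FreeAlgebra ℂ ι))).restrictScalars ℂ

theorem vacuumState_apply (x : DualNumber (Module.End ℂ (FreeAlgebra ℂ ι))) :
    vacuumState ι x = vacuum ι (x.fst 1) := rfl

theorem vacuumState'_apply (x : DualNumber (Module.End ℂ (FreeAlgebra ℂ ι))) :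
    vacuumState' ι x = vacuum ι (x.snd 1) := rfl

variable [DecidableEq ι]

/-- The transition operator of the recursion that defines `toeplitz`. -/
noncomputable def toeplitzStep (i a : ι) :
    Module.End ℂ (FreeAlgebra ℂ ι × ((ℕ → ℂ) → FreeAlgebra ℂ ι)) where
  toFun v := (FreeAlgebra.ι ℂ a * v.1, fun κ => κ 0 • (FreeAlgebra.ι ℂ a * v.1) +
    if a = i then v.2 fun n => κ (n + 1) else 0)
  map_add' v w := by
    ext κ
    · simp [mul_add]
    · by_cases h : a = i <;> simp [mul_add, h]
      abel
  map_smul' c v := by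
    ext κ
    · simp
    · by_cases h : a = i <;> simp [h, smul_comm c (κ 0)]

/-- The operator `∑ₖ κₖ Lᵏ` on the free algebra, regarded as the full Fock space, where `L`
annihilates a leading letter `i`. -/
noncomputable def toeplitz (i : ι) (κ : ℕ → ℂ) : Module.End ℂ (FreeAlgebra ℂ ι) :=
  LinearMap.proj κ ∘ₗ LinearMap.snd ℂ _ _ ∘ₗ
    LinearMap.applyₗ ((1 : FreeAlgebra ℂ ι), fun κ : ℕ → ℂ => κ 0 • (1 : FreeAlgebra ℂ ι)) ∘ₗ
    (FreeAlgebra.lift ℂ (toeplitzStep i)).toLinearMap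

@[simp] theorem toeplitz_one (i : ι) (κ : ℕ → ℂ) : toeplitz i κ 1 = κ 0 • 1 := by
  simp [toeplitz]

/-- The first component keeps the word read so far, which the recursion needs for its `κ 0` term. -/
theorem toeplitzStep_lift_fst (i : ι) (f : FreeAlgebra ℂ ι)
    (v : FreeAlgebra ℂ ι × ((ℕ → ℂ) → FreeAlgebra ℂ ι)) :
    (FreeAlgebra.lift ℂ (toeplitzStep i) f v).1 = f * v.1 := by
  induction f using freeAlgebra_induction_left with
  | one => simp
  | add f g hf hg => simp [add_mul, hf, hg]
  | smul c f hf => simp [hf]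
  | mul a f hf => simp [toeplitzStep, hf, mul_assoc]

theorem toeplitz_ι_mul (i a : ι) (κ : ℕ → ℂ) (f : FreeAlgebra ℂ ι) :
    toeplitz i κ (FreeAlgebra.ι ℂ a * f) = κ 0 • (FreeAlgebra.ι ℂ a * f) +
      if a = i then toeplitz i (fun n => κ (n + 1)) f else 0 := by
  have := toeplitzStep_lift_fst i f (1, fun κ => κ 0 • 1)
  simp [toeplitz, toeplitzStep] at this ⊢
  rw [this]

@[simp] theorem toeplitz_ι_mul_self (i : ι) (κ : ℕ → ℂ) (f : FreeAlgebra ℂ ι) :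
    toeplitz i κ (FreeAlgebra.ι ℂ i * f) = κ 0 • (FreeAlgebra.ι ℂ i * f) +
      toeplitz i (fun n => κ (n + 1)) f := by
  simp [toeplitz_ι_mul]

theorem toeplitz_ι_mul_of_ne {i a : ι} (h : a ≠ i) (κ : ℕ → ℂ) (f : FreeAlgebra ℂ ι) :
    toeplitz i κ (FreeAlgebra.ι ℂ a * f) = κ 0 • (FreeAlgebra.ι ℂ a * f) := by
  simp [toeplitz_ι_mul, h]

theorem toeplitz_add (i : ι) (κ κ' : ℕ → ℂ) :
    toeplitz i (κ + κ') = toeplitz i κ + toeplitz i κ' := by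
  ext f
  induction f using freeAlgebra_induction_left generalizing κ κ' with
  | one => simp [add_smul]
  | add f g hf hg => simp only [map_add, hf, hg]
  | smul c f hf => simp only [map_smul, hf]
  | mul a f hf =>
    have := hf (fun n => κ (n + 1)) (fun n => κ' (n + 1))
    simp only [LinearMap.add_apply] at this ⊢
    rw [toeplitz_ι_mul, toeplitz_ι_mul, toeplitz_ι_mul]
    split_ifs
    · change (κ 0 + κ' 0) • (FreeAlgebra.ι ℂ a * f) +
        toeplitz i ((fun n => κ (n + 1)) + fun n => κ' (n + 1)) f = _
      rw [this, add_smul]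
      abel
    · simp [add_smul]

/-- The operator with free cumulants `κ 0, κ 1, …` on the full Fock space, perturbed to first
order by the creation operator. -/
noncomputable def fockVariable (i : ι) (κ : ℕ → ℂ) :
    DualNumber (Module.End ℂ (FreeAlgebra ℂ ι)) :=
  TrivSqZeroExt.inl (creation i + toeplitz i κ) - TrivSqZeroExt.inr (creation i)

@[simp] theorem fst_fockVariable (i : ι) (κ : ℕ → ℂ) :
    (fockVariable i κ).fst = creation i + toeplitz i κ := by
  simp [fockVariable]

@[simp] theorem snd_fockVariable (i : ι) (κ : ℕ → ℂ) :
    (fockVariable i κ).snd = - creation i := by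
  simp [fockVariable]

end Toeplitz

/-! ### Embedding the one-letter Fock space; additivity -/

section Intertwine

variable {M F : Type*} [AddCommGroup M] [Module ℂ M] [AddCommGroup F] [Module ℂ F]

theorem dualNumber_pow_intertwine (J : M →ₗ[ℂ] F) (x : DualNumber (Module.End ℂ M))
    (y : DualNumber (Module.End ℂ F)) (hfst : ∀ f, J (x.fst f) = y.fst (J f))
    (hsnd : ∀ f, J (x.snd f) = y.snd (J f)) (n : ℕ) :
    (∀ f, J ((x ^ n).fst f) = (y ^ n).fst (J f)) ∧
      ∀ f, J ((x ^ n).snd f) = (y ^ n).snd (J f) := by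
  induction n with
  | zero => simp
  | succ n ih =>
    rw [pow_succ, pow_succ]
    simp [TrivSqZeroExt.snd_mul, ih.1, ih.2, hfst, hsnd, -TrivSqZeroExt.fst_pow]

end Intertwine

section Shift

variable {ι : Type*}

/-- Substituting `s` for the letter fixes `1` and preserves the vacuum coefficient, so an
intertwined operator has the same moments. -/
theorem vacuumState_pow_eq (s : FreeAlgebra ℂ ι) (hs : vacuum ι s = 0) (κ : ℕ → ℂ)
    (y : DualNumber (Module.End ℂ (FreeAlgebra ℂ ι)))
    (hfst : ∀ f, FreeAlgebra.lift ℂ (fun _ : Unit => s) ((fockVariable () κ).fst f) =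
      y.fst (FreeAlgebra.lift ℂ (fun _ : Unit => s) f))
    (hsnd : ∀ f, FreeAlgebra.lift ℂ (fun _ : Unit => s) ((fockVariable () κ).snd f) =
      y.snd (FreeAlgebra.lift ℂ (fun _ : Unit => s) f)) (n : ℕ) :
    vacuumState ι (y ^ n) = vacuumState Unit (fockVariable () κ ^ n) ∧
      vacuumState' ι (y ^ n) = vacuumState' Unit (fockVariable () κ ^ n) := by
  obtain ⟨h1, h2⟩ := dualNumber_pow_intertwine
    (FreeAlgebra.lift ℂ (fun _ : Unit => s)).toLinearMap (fockVariable () κ) y hfst hsnd n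
  have h1 := congrArg (vacuum ι) (h1 1)
  have h2 := congrArg (vacuum ι) (h2 1)
  simp only [AlgHom.toLinearMap_apply, vacuum_lift s hs, map_one] at h1 h2
  exact ⟨h1.symm, h2.symm⟩

variable [DecidableEq ι]

/-- The one-letter Fock space is embedded in the Fock space along powers of `s`. -/
theorem lift_toeplitz (i : ι) (s : FreeAlgebra ℂ ι)
    (hs : ∀ (κ : ℕ → ℂ) v, toeplitz i κ (s * v) =
      κ 0 • (s * v) + toeplitz i (fun n => κ (n + 1)) v) (κ : ℕ → ℂ) (f : FreeAlgebra ℂ Unit) :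
    FreeAlgebra.lift ℂ (fun _ : Unit => s) (toeplitz () κ f) =
      toeplitz i κ (FreeAlgebra.lift ℂ (fun _ : Unit => s) f) := by
  induction f using freeAlgebra_induction_left generalizing κ with
  | one => simp
  | add f g hf hg => simp only [map_add, hf, hg]
  | smul c f hf => simp only [map_smul, hf]
  | mul a f hf => simp [hs, hf]

theorem distribution_fockVariable (i : ι) (κ : ℕ → ℂ) :
    distribution (vacuumState ι) (fockVariable i κ) =
        distribution (vacuumState Unit) (fockVariable () κ) ∧
      distribution (vacuumState' ι) (fockVariable i κ) =
        distribution (vacuumState' Unit) (fockVariable () κ) := by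
  have h := vacuumState_pow_eq (FreeAlgebra.ι ℂ i) (vacuum_ι i) κ (fockVariable i κ)
    (by
      intro f
      simp only [fst_fockVariable, LinearMap.add_apply, map_add, creation_apply, map_mul,
        FreeAlgebra.lift_ι_apply]
      rw [lift_toeplitz i _ (fun κ v => toeplitz_ι_mul_self i κ v)])
    (by simp)
  constructor <;> refine distribution_ext fun n => ?_ <;> rw [distribution_X_pow,
    distribution_X_pow]
  exacts [(h n).1, (h n).2]

/-- Take `s` to be the sum of the two letters. The two creation operators add up to multiplication
by `s`, and removing a leading `i`, or a leading `j`, from `s * v` gives `v` in either case. -/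
theorem distribution_fockVariable_add {i j : ι} (hij : i ≠ j) (κ κ' : ℕ → ℂ) :
    distribution (vacuumState ι) (fockVariable i κ + fockVariable j κ') =
        distribution (vacuumState Unit) (fockVariable () (κ + κ')) ∧
      distribution (vacuumState' ι) (fockVariable i κ + fockVariable j κ') =
        distribution (vacuumState' Unit) (fockVariable () (κ + κ')) := by
  have h := vacuumState_pow_eq (FreeAlgebra.ι ℂ i + FreeAlgebra.ι ℂ j) (by simp) (κ + κ')
    (fockVariable i κ + fockVariable j κ')
    (by
      intro f
      simp only [fst_fockVariable, LinearMap.add_apply, map_add, creation_apply, map_mul,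
        FreeAlgebra.lift_ι_apply, TrivSqZeroExt.fst_add, toeplitz_add]
      rw [lift_toeplitz i, lift_toeplitz j, add_mul]
      · abel
      · intro κ v
        rw [add_mul, map_add, toeplitz_ι_mul_of_ne hij, toeplitz_ι_mul_self, smul_add]
        abel
      · intro κ v
        rw [add_mul, map_add, toeplitz_ι_mul_of_ne hij.symm, toeplitz_ι_mul_self, smul_add]
        abel)
    (by intro f; simp [add_mul]; abel)
  constructor <;> refine distribution_ext fun n => ?_ <;> rw [distribution_X_pow,
    distribution_X_pow]
  exacts [(h n).1, (h n).2]

end Shift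

/-! ### One letter: surjectivity and the Markov–Krein identity -/

section OneLetter

/-- Removal of a leading letter: the annihilation operator of the one-letter Fock space. -/
noncomputable def annihilation : Module.End ℂ (FreeAlgebra ℂ Unit) :=
  toeplitz () (Pi.single 1 1)

@[simp] theorem annihilation_one : annihilation 1 = 0 := by simp [annihilation]

theorem toeplitz_zero (f : FreeAlgebra ℂ Unit) : toeplitz () 0 f = 0 := by
  have := LinearMap.congr_fun (toeplitz_add () 0 0) f
  simpa using this

@[simp] theorem annihilation_ι_mul (f : FreeAlgebra ℂ Unit) :
    annihilation (FreeAlgebra.ι ℂ () * f) = f := by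
  have h : (fun n : ℕ => (Pi.single 1 1 : ℕ → ℂ) (n + 1)) = Pi.single 0 1 := by
    ext n; simp [Pi.single_apply]
  have h' : (fun n : ℕ => (Pi.single 0 1 : ℕ → ℂ) (n + 1)) = 0 := by
    ext n; simp
  have key : ∀ f : FreeAlgebra ℂ Unit, toeplitz () (Pi.single 0 1) f = f := by
    intro f
    induction f using freeAlgebra_induction_left with
    | one => simp
    | add f g hf hg => simp only [map_add, hf, hg]
    | smul c f hf => simp only [map_smul, hf]
    | mul a f hf =>
      rw [toeplitz_ι_mul_self, h', toeplitz_zero]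
      simp
  simp [annihilation, h, key]

@[simp] theorem annihilation_ι : annihilation (FreeAlgebra.ι ℂ ()) = 1 := by
  simpa using annihilation_ι_mul 1

theorem ι_mul_annihilation (f : FreeAlgebra ℂ Unit) :
    FreeAlgebra.ι ℂ () * annihilation f = f - vacuum Unit f • 1 := by
  induction f using freeAlgebra_induction_left with
  | one => simp
  | add f g hf hg => simp only [map_add, mul_add, hf, hg, add_smul]; abel
  | smul c f hf => simp [hf, smul_sub, mul_smul]
  | mul a f hf => cases a; simp

theorem toeplitz_eq (κ : ℕ → ℂ) (f : FreeAlgebra ℂ Unit) :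
    toeplitz () κ f = κ 0 • f + toeplitz () (fun n => κ (n + 1)) (annihilation f) := by
  induction f using freeAlgebra_induction_left with
  | one => simp
  | add f g hf hg => simp only [map_add, hf, hg, smul_add]; abel
  | smul c f hf => simp only [map_smul, hf, smul_add, smul_comm c (κ 0)]
  | mul a f hf => cases a; simp

theorem annihilation_toeplitz (κ : ℕ → ℂ) (f : FreeAlgebra ℂ Unit) :
    annihilation (toeplitz () κ f) = toeplitz () κ (annihilation f) := by
  induction f using freeAlgebra_induction_left generalizing κ with
  | one => simp
  | add f g hf hg => simp only [map_add, hf, hg]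
  | smul c f hf => simp only [map_smul, hf]
  | mul a f hf => cases a; simp [hf, toeplitz_eq κ f]

/-- Both operators are series in the one operator `annihilation`. -/
theorem toeplitz_comm (κ κ' : ℕ → ℂ) (f : FreeAlgebra ℂ Unit) :
    toeplitz () κ (toeplitz () κ' f) = toeplitz () κ' (toeplitz () κ f) := by
  -- Peeling off constant terms with `toeplitz_eq` leaves operators applied to `annihilation f`, so
  -- the induction must carry that case along.
  suffices h : ∀ κ κ' : ℕ → ℂ,
      toeplitz () κ (toeplitz () κ' f) = toeplitz () κ' (toeplitz () κ f) ∧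
      toeplitz () κ (toeplitz () κ' (annihilation f)) =
        toeplitz () κ' (toeplitz () κ (annihilation f)) from (h κ κ').1
  induction f using freeAlgebra_induction_left with
  | one => intro κ κ'; simp [smul_smul, mul_comm]
  | add f g hf hg =>
    intro κ κ'
    simp only [map_add, (hf κ κ').1, (hf κ κ').2, (hg κ κ').1, (hg κ κ').2, and_self]
  | smul c f hf => intro κ κ'; simp only [map_smul, (hf κ κ').1, (hf κ κ').2, and_self]
  | mul a f hf =>
    intro κ κ'
    cases a
    simp only [annihilation_ι_mul, hf κ κ', and_true]
    simp only [toeplitz_ι_mul_self, map_add, map_smul]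
    rw [toeplitz_eq κ (toeplitz () _ f), toeplitz_eq κ' (toeplitz () _ f),
      annihilation_toeplitz, annihilation_toeplitz, (hf _ _).2, smul_add, smul_add,
      smul_comm (κ 0) (κ' 0)]
    abel

/-- The vector `bⁿ Ω`, where `b` is the operator with free cumulants `κ`. -/
noncomputable def fockVector (κ : ℕ → ℂ) (n : ℕ) : FreeAlgebra ℂ Unit :=
  ((fockVariable () κ) ^ n).fst 1

/-- The first-order perturbation of `fockVector`. -/
noncomputable def fockVector' (κ : ℕ → ℂ) (n : ℕ) : FreeAlgebra ℂ Unit :=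
  ((fockVariable () κ) ^ n).snd 1

@[simp] theorem fockVector_zero (κ : ℕ → ℂ) : fockVector κ 0 = 1 := by simp [fockVector]

@[simp] theorem fockVector'_zero (κ : ℕ → ℂ) : fockVector' κ 0 = 0 := by simp [fockVector']

theorem fockVector_succ (κ : ℕ → ℂ) (n : ℕ) : fockVector κ (n + 1) =
    FreeAlgebra.ι ℂ () * fockVector κ n + toeplitz () κ (fockVector κ n) := by
  rw [fockVector, pow_succ', TrivSqZeroExt.fst_mul, fst_fockVariable]
  rfl

theorem fockVector'_succ (κ : ℕ → ℂ) (n : ℕ) : fockVector' κ (n + 1) =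
    FreeAlgebra.ι ℂ () * fockVector' κ n + toeplitz () κ (fockVector' κ n) -
      FreeAlgebra.ι ℂ () * fockVector κ n := by
  rw [fockVector', pow_succ', TrivSqZeroExt.snd_mul]
  simp [fockVector', fockVector, sub_eq_add_neg]

/-- The vector has degree `n` and leading coefficient `1`, so only the term of order `n` survives.
-/
theorem toeplitz_fockVector (κ : ℕ → ℂ) (n : ℕ) (d : ℕ → ℂ) (hd : ∀ k < n, d k = 0) :
    toeplitz () d (fockVector κ n) = d n • 1 := by
  induction n generalizing d with
  | zero => simp
  | succ n ih =>
    rw [fockVector_succ, map_add, toeplitz_comm, ih d fun k hk => hd k (by omega),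
      hd n (by omega), toeplitz_ι_mul_self, hd 0 (by omega),
      ih (fun n => d (n + 1)) fun k hk => hd (k + 1) (by omega)]
    simp

theorem fockVector_congr (κ κ' : ℕ → ℂ) (n : ℕ) (h : ∀ k < n, κ k = κ' k) :
    fockVector κ n = fockVector κ' n := by
  induction n with
  | zero => simp
  | succ n ih =>
    have hd := toeplitz_fockVector κ' n (κ - κ') fun k hk => by simp [h k (by omega)]
    have e : toeplitz () κ (fockVector κ' n) = toeplitz () κ' (fockVector κ' n) := by
      conv_lhs => rw [show κ = (κ - κ') + κ' by abel, toeplitz_add, LinearMap.add_apply, hd]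
      simp [h n (by omega)]
    rw [fockVector_succ, fockVector_succ, ih fun k hk => h k (by omega), e]

theorem vacuum_fockVector_succ_sub (κ κ' : ℕ → ℂ) (n : ℕ) (h : ∀ k < n, κ k = κ' k) :
    vacuum Unit (fockVector κ (n + 1)) - vacuum Unit (fockVector κ' (n + 1)) = κ n - κ' n := by
  have hd := toeplitz_fockVector κ' n (κ - κ') fun k hk => by simp [h k hk]
  rw [fockVector_succ, fockVector_succ, fockVector_congr κ κ' n h]
  conv_lhs =>
    enter [1]
    rw [show κ = (κ - κ') + κ' by abel, toeplitz_add, LinearMap.add_apply, hd]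
  simp

/-- The solution of a triangular system of equations. -/
noncomputable def triangularSolution (m : (ℕ → ℂ) → ℕ → ℂ) (μ : ℕ → ℂ) : ℕ → ℂ
  | n => μ n - m (fun k => if _h : k < n then triangularSolution m μ k else 0) n

/-- By `hm`, `m κ n` is `κ n` plus a quantity depending on earlier entries only. That quantity is
read off from the sequence truncated to `0` from `n` on. -/
theorem exists_eq_of_triangular (m : (ℕ → ℂ) → ℕ → ℂ)
    (hm : ∀ (κ κ' : ℕ → ℂ) n, (∀ k < n, κ k = κ' k) → m κ n - m κ' n = κ n - κ' n)
    (μ : ℕ → ℂ) : ∃ κ, m κ = μ := by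
  refine ⟨triangularSolution m μ, funext fun n => ?_⟩
  have h := hm (triangularSolution m μ)
    (fun k => if _h : k < n then triangularSolution m μ k else 0) n
    fun k hk => by simp [hk]
  rw [sub_eq_iff_eq_add] at h
  rw [h, triangularSolution]
  simp

/-- Every distribution is the vacuum distribution of an operator on the one-letter Fock space. -/
theorem exists_distribution_fockVariable_eq (μ : Distribution) (hμ : μ 1 = 1) :
    ∃ κ, distribution (vacuumState Unit) (fockVariable () κ) = μ := by
  obtain ⟨κ, hκ⟩ := exists_eq_of_triangular
    (fun κ n => vacuum Unit (fockVector κ (n + 1))) vacuum_fockVector_succ_sub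
    (fun n => μ (Polynomial.X ^ (n + 1)))
  refine ⟨κ, distribution_ext fun n => ?_⟩
  rw [distribution_X_pow, vacuumState_apply]
  cases n with
  | zero => simp [hμ]
  | succ n => exact congrFun hκ n

theorem sum_fockVector_succ (κ : ℕ → ℂ) (n : ℕ) :
    ∑ p ∈ antidiagonal n, vacuum Unit (fockVector κ p.2) • fockVector κ (p.1 + 1) =
      (creation () + toeplitz () κ)
        (∑ p ∈ antidiagonal n, vacuum Unit (fockVector κ p.2) • fockVector κ p.1) := by
  simp only [fockVector_succ, map_sum, map_smul, LinearMap.add_apply, creation_apply]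

/-- With `b` the one-letter operator, annihilation commutes with `b` up to the vacuum projection.
Moving it through the power leaves one term for each factor `b`. -/
theorem annihilation_fockVector_succ (κ : ℕ → ℂ) (n : ℕ) :
    annihilation (fockVector κ (n + 1)) = ∑ p ∈ antidiagonal n,
      vacuum Unit (fockVector κ p.2) • fockVector κ p.1 := by
  induction n with
  | zero => simp [fockVector_succ]
  | succ n ih =>
    rw [fockVector_succ, map_add, annihilation_ι_mul, annihilation_toeplitz,
      Nat.sum_antidiagonal_succ, sum_fockVector_succ, ← ih, LinearMap.add_apply, creation_apply,
      ι_mul_annihilation, fockVector_zero]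
    abel

/-- The induction applies `b` to both sides. The perturbation contributes the letter times
`annihilation (fockVector κ (n + 1))`, i.e. the vector less its vacuum part; this raises the factor
`n + 1` by one and supplies the missing boundary term. -/
theorem sum_fockVector' (κ : ℕ → ℂ) (n : ℕ) :
    ∑ p ∈ antidiagonal n, vacuum Unit (fockVector κ p.2) • fockVector' κ p.1 =
      ∑ p ∈ antidiagonal n, vacuum Unit (fockVector κ p.2) • fockVector κ p.1 -
        (n + 1 : ℂ) • fockVector κ n := by
  induction n with
  | zero => simp
  | succ n ih =>
    have ha := ι_mul_annihilation (fockVector κ (n + 1))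
    rw [annihilation_fockVector_succ] at ha
    rw [Nat.sum_antidiagonal_succ, Nat.sum_antidiagonal_succ]
    have hy : ∑ p ∈ antidiagonal n, vacuum Unit (fockVector κ p.2) • fockVector' κ (p.1 + 1) =
        (creation () + toeplitz () κ)
          (∑ p ∈ antidiagonal n, vacuum Unit (fockVector κ p.2) • fockVector' κ p.1) -
        FreeAlgebra.ι ℂ () *
          ∑ p ∈ antidiagonal n, vacuum Unit (fockVector κ p.2) • fockVector κ p.1 := by
      simp only [fockVector'_succ, map_sum, map_smul, LinearMap.add_apply, creation_apply,
        mul_sum, smul_sub, sum_sub_distrib, mul_smul_comm]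
    rw [hy, ha, ih, map_sub, ← sum_fockVector_succ, map_smul, LinearMap.add_apply, creation_apply,
      ← fockVector_succ]
    simp only [fockVector'_zero, fockVector_zero, smul_zero, zero_add]
    push_cast
    module

/-- The first-order perturbation of the vacuum distribution is governed by the inverse
Markov–Krein transform. -/
theorem isInverseMarkovKrein_fockVariable (κ : ℕ → ℂ) :
    IsInverseMarkovKrein (distribution (vacuumState Unit) (fockVariable () κ))
      (distribution (vacuumState Unit) (fockVariable () κ) -
        distribution (vacuumState' Unit) (fockVariable () κ)) := by
  have hM : ∀ n, distribution (vacuumState Unit) (fockVariable () κ) (Polynomial.X ^ n) =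
      vacuum Unit (fockVector κ n) := fun n => distribution_X_pow _ _ n
  have hM' : ∀ n, distribution (vacuumState' Unit) (fockVariable () κ) (Polynomial.X ^ n) =
      vacuum Unit (fockVector' κ n) := fun n => distribution_X_pow _ _ n
  unfold IsInverseMarkovKrein zDeriv cauchyTransform
  simp only [hM, hM', LinearMap.sub_apply]
  rw [neg_inj, mul_mul_mul_comm, ← sq]
  congr 1
  ext n
  -- The vacuum component is the coefficient identity: the factor `n + 1` comes from differentiating
  -- `X` times the moment series.
  have h := congrArg (vacuum Unit) (sum_fockVector' κ n)
  simp only [map_sub, map_sum, map_smul, smul_eq_mul] at h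
  have hc : ∀ f : ℕ → ℂ, ∑ p ∈ antidiagonal n, f p.1 * vacuum Unit (fockVector κ p.2) =
      ∑ p ∈ antidiagonal n, vacuum Unit (fockVector κ p.2) * f p.1 :=
    fun f => sum_congr rfl fun _ _ => mul_comm _ _
  rw [PowerSeries.coeff_derivative, PowerSeries.coeff_succ_X_mul, PowerSeries.coeff_mul]
  simp only [PowerSeries.coeff_mk, sub_mul, sum_sub_distrib]
  rw [hc fun n => vacuum Unit (fockVector κ n), hc fun n => vacuum Unit (fockVector' κ n), h]
  ring

end OneLetter

/-! ### Alternating products and freeness -/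

section OrderedProd

variable {B : Type*} [Ring B]

@[simp] theorem orderedProd_zero (b : ℕ → B) : orderedProd 0 b = 1 := rfl

theorem orderedProd_succ (n : ℕ) (b : ℕ → B) :
    orderedProd (n + 1) b = orderedProd n b * b n := by
  simp [orderedProd, List.range_succ]

theorem orderedProd_succ' (n : ℕ) (b : ℕ → B) :
    orderedProd (n + 1) b = b 0 * orderedProd n fun k => b (k + 1) := by
  simp [orderedProd, List.range_succ_eq_map, Function.comp_def]

theorem orderedProd_congr {n : ℕ} {b c : ℕ → B} (h : ∀ k < n, b k = c k) :
    orderedProd n b = orderedProd n c := by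
  unfold orderedProd
  congr 1
  exact List.map_congr_left fun k hk => h k (List.mem_range.1 hk)

theorem orderedProd_add (p q : ℕ) (b : ℕ → B) :
    orderedProd (p + q) b = orderedProd p b * orderedProd q fun k => b (p + k) := by
  simp [orderedProd, List.range_add, Function.comp_def]

end OrderedProd

section Freeness

variable {B : Type*} [Ring B] [Algebra ℂ B] {ι : Type*} {φ : B →ₗ[ℂ] ℂ}
  {S : ι → Subalgebra ℂ B}

theorem FreelyIndependent.mul_eq_zero (hS : FreelyIndependent φ S) {p q : ℕ} {i j : ℕ → ι}
    {b d : ℕ → B} (hi : Alternating p i) (hj : Alternating q j) (hb : CenteredIn φ S p i b)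
    (hd : CenteredIn φ S q j d) (hij : ∀ k, p = k + 1 → i k ≠ j 0) (hq : 0 < q) :
    φ (orderedProd p b * orderedProd q d) = 0 := by
  have h := hS (p + q) (fun k => if k < p then i k else j (k - p))
    (fun k => if k < p then b k else d (k - p)) (by omega) ?_ ?_
  · rw [orderedProd_add, orderedProd_congr (c := b) fun k hk => by simp [hk]] at h
    simpa using h
  · intro k hk
    dsimp only
    split_ifs with h1 h2 h2
    · exact hi k h2
    · have : k + 1 - p = 0 := by omega
      rw [this]
      exact hij k (by omega)
    · omega
    · have := hj (k - p) (by omega)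
      rwa [show k + 1 - p = k - p + 1 by omega]
  · intro k hk
    dsimp only
    split_ifs with h1
    · exact hb k h1
    · exact hd (k - p) (by omega)

open Classical in
/-- The moment of two alternating centered products, multiplied together, in free subalgebras. -/
theorem FreelyIndependent.mul (hS : FreelyIndependent φ S) (h1 : φ 1 = 1) {p q : ℕ}
    {i j : ℕ → ι} {b d : ℕ → B} (hi : Alternating p i) (hj : Alternating q j)
    (hb : CenteredIn φ S p i b) (hd : CenteredIn φ S q j d) :
    φ (orderedProd p b * orderedProd q d) =
      if p = q ∧ ∀ k < p, i k = j (p - 1 - k) then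
        ∏ k ∈ range p, φ (b k * d (p - 1 - k)) else 0 := by
  induction p generalizing q j d with
  | zero =>
    cases q with
    | zero => simp [h1]
    | succ q => simp [hS (q + 1) j d (by omega) hj hd]
  | succ p ih =>
    cases q with
    | zero => simp [hS (p + 1) i b (by omega) hi hb]
    | succ q =>
      by_cases hij : i p = j 0
      · have hS' : ∀ x c, b p * d 0 = x + c • 1 →
            φ (orderedProd (p + 1) b * orderedProd (q + 1) d) =
              φ (orderedProd p b * orderedProd (q + 1) (Function.update d 0 x)) +
              c * φ (orderedProd p b * orderedProd q fun k => d (k + 1)) := by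
          intro x c hx
          rw [orderedProd_succ, orderedProd_succ', orderedProd_succ', mul_assoc,
            ← mul_assoc (b p), hx]
          simp [add_mul, mul_add]
        -- At the junction, the centered part of `b p * d 0` leaves an alternating centered product,
        -- which vanishes; the scalar part cancels the pair and recurses.
        rw [hS' (b p * d 0 - φ (b p * d 0) • 1) (φ (b p * d 0)) (by simp), ih (j := fun k => j (k + 1))
          (fun k hk => hi k (by omega)) (fun k hk => hj (k + 1) (by omega))
          (fun k hk => hb k (by omega)) (fun k hk => hd (k + 1) (by omega)),
          hS.mul_eq_zero (i := i) (j := j) (fun k hk => hi k (by omega)) hj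
          (fun k hk => hb k (by omega)) _ _ (by omega), zero_add]
        · have hc : (p + 1 = q + 1 ∧ ∀ k < p + 1, i k = j (p + 1 - 1 - k)) ↔
              (p = q ∧ ∀ k < p, i k = j (p - 1 - k + 1)) := by
            refine and_congr (by omega) ⟨fun h k hk => ?_, fun h k hk => ?_⟩
            · rw [h k (by omega)]; congr 1; omega
            · rcases Nat.lt_succ_iff_lt_or_eq.1 hk with hk | rfl
              · rw [h k hk]; congr 1; omega
              · simpa using hij
          rw [if_congr hc rfl rfl, prod_range_succ, mul_ite, mul_zero]
          congr 1
          rw [mul_comm]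
          congr 1
          · refine prod_congr rfl fun k hk => ?_
            have := mem_range.1 hk
            rw [show p - 1 - k + 1 = p + 1 - 1 - k by omega]
          · simp
        · intro k hk
          rcases Nat.eq_zero_or_pos k with rfl | hk0
          · refine ⟨?_, by simp [h1]⟩
            rw [Function.update_self]
            have hbp := (hb p (by omega)).1
            rw [hij] at hbp
            exact sub_mem (mul_mem hbp (hd 0 hk).1) (Subalgebra.smul_mem _ (one_mem _) _)
          · rw [Function.update_of_ne (by omega)]
            exact hd k hk
        · rintro k rfl
          rw [← hij]
          exact hi k (by omega)
      · rw [hS.mul_eq_zero hi hj hb hd _ (by omega), if_neg]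
        · rintro ⟨-, h⟩
          exact hij (by simpa using h p (by omega))
        · intro k hk
          obtain rfl : p = k := by omega
          exact hij

/-- Infinitesimal freeness follows from freeness and the Leibniz-type formula for `φ'`. -/
theorem FreelyIndependent.infinitesimallyFree (hS : FreelyIndependent φ S) (h1 : φ 1 = 1)
    (φ' : B →ₗ[ℂ] ℂ) (hφ' : ∀ (n : ℕ) (i : ℕ → ι) (b : ℕ → B), Alternating n i →
      CenteredIn φ S n i b → φ' (orderedProd n b) = ∑ k ∈ range n,
        φ' (b k) * φ (orderedProd k b * orderedProd (n - 1 - k) fun l => b (k + 1 + l))) :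
    InfinitesimallyFree φ φ' S := by
  classical
  intro n i b hn hi hb
  refine ⟨hS n i b hn hi hb, ?_⟩
  -- The two words flanking position `k` pair nontrivially only if they have equal length, so only
  -- the middle `k` survives.
  have key : ∀ k ∈ range n,
      φ (orderedProd k b * orderedProd (n - 1 - k) fun l => b (k + 1 + l)) =
        if n = 2 * k + 1 ∧ ∀ l < n / 2, i l = i (n - 1 - l) then
          ∏ l ∈ range (n / 2), φ (b l * b (n - 1 - l)) else 0 := by
    intro k hk
    have hk := mem_range.1 hk
    rw [hS.mul h1 (i := i) (j := fun l => i (k + 1 + l)) (fun l hl => hi l (by omega))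
      (fun l hl => hi (k + 1 + l) (by omega)) (fun l hl => hb l (by omega))
      (fun l hl => hb (k + 1 + l) (by omega))]
    by_cases h : n = 2 * k + 1
    · obtain rfl : k = n / 2 := by omega
      have e : ∀ l < n / 2, n / 2 + 1 + (n / 2 - 1 - l) = n - 1 - l := by omega
      refine if_congr (and_congr (by omega) (forall₂_congr fun l hl => by rw [e l hl]))
        (prod_congr rfl fun l hl => by rw [e l (mem_range.1 hl)]) rfl
    · rw [if_neg fun h' => h (by omega), if_neg fun h' => h h'.1]
  rw [hφ' n i b hi hb, sum_congr rfl fun k hk => by rw [key k hk]]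
  by_cases hodd : Odd n
  · obtain ⟨m, rfl⟩ := hodd
    have hm : (2 * m + 1) / 2 = m := by omega
    rw [sum_eq_single m]
    · rw [hm, mul_ite, mul_zero, mul_comm (φ' _)]
      exact if_congr (and_congr (by simp) Iff.rfl) rfl rfl
    · intro k _ hk
      rw [if_neg fun h' => hk (by omega), mul_zero]
    · simp; omega
  · rw [if_neg fun h' => hodd h'.1]
    refine sum_eq_zero fun k _ => ?_
    rw [if_neg fun h' => hodd ⟨k, h'.1⟩, mul_zero]

theorem InfinitesimallyFree.freelyIndependent {φ' : B →ₗ[ℂ] ℂ}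
    (h : InfinitesimallyFree φ φ' S) : FreelyIndependent φ S :=
  fun n i b hn hi hb => (h n i b hn hi hb).1

theorem InfinitesimallyFree.comp {φ' : B →ₗ[ℂ] ℂ} (h : InfinitesimallyFree φ φ' S)
    {κ : Type*} {f : κ → ι} (hf : Function.Injective f) :
    InfinitesimallyFree φ φ' fun k => S (f k) := by
  classical
  intro n i b hn hi hb
  obtain ⟨h1, h2⟩ := h n (fun k => f (i k)) b hn (fun k hk => hf.ne (hi k hk)) hb
  refine ⟨h1, h2.trans (if_congr ?_ rfl rfl)⟩
  simp only [hf.eq_iff]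

end Freeness

/-! ### Infinitesimal freeness on the Fock space -/

section FockFreeness

variable {ι : Type*}

/-- The polynomials in the letter `i`. -/
noncomputable def letterSubalgebra (i : ι) : Subalgebra ℂ (FreeAlgebra ℂ ι) :=
  (FreeAlgebra.lift ℂ fun _ : Unit => FreeAlgebra.ι ℂ i).range

theorem exists_eq_vacuum_add {i : ι} {v : FreeAlgebra ℂ ι} (hv : v ∈ letterSubalgebra i) :
    ∃ r, v = vacuum ι v • 1 + FreeAlgebra.ι ℂ i * r := by
  obtain ⟨f, rfl⟩ := hv
  have h := congrArg (FreeAlgebra.lift ℂ fun _ : Unit => FreeAlgebra.ι ℂ i) (ι_mul_annihilation f)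
  rw [map_mul, map_sub, map_smul, map_one, FreeAlgebra.lift_ι_apply] at h
  refine ⟨FreeAlgebra.lift ℂ (fun _ : Unit => FreeAlgebra.ι ℂ i) (annihilation f), ?_⟩
  change FreeAlgebra.lift ℂ _ f = vacuum ι (FreeAlgebra.lift ℂ _ f) • 1 + _
  rw [vacuum_lift _ (vacuum_ι i), h]
  abel

variable [DecidableEq ι]

/-- The vectors without words that start with the letter `i`. -/
def NotStartingWith (i : ι) (w : FreeAlgebra ℂ ι) : Prop :=
  ∀ κ, toeplitz i κ w = κ 0 • w

theorem notStartingWith_one (i : ι) : NotStartingWith i (1 : FreeAlgebra ℂ ι) :=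
  fun κ => toeplitz_one i κ

theorem notStartingWith_ι_mul {i j : ι} (h : j ≠ i) (r : FreeAlgebra ℂ ι) :
    NotStartingWith i (FreeAlgebra.ι ℂ j * r) :=
  fun κ => toeplitz_ι_mul_of_ne h κ r

/-- The operators which act on the leading powers of the letter `i` only. -/
noncomputable def leadingOperators (i : ι) : Subalgebra ℂ (Module.End ℂ (FreeAlgebra ℂ ι)) where
  carrier := {f | ∀ u ∈ letterSubalgebra i, f u ∈ letterSubalgebra i ∧
    ∀ w, NotStartingWith i w → f (u * w) = f u * w}
  mul_mem' := by
    intro f g hf hg u hu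
    refine ⟨(hf _ (hg u hu).1).1, fun w hw => ?_⟩
    simp only [Module.End.mul_apply]
    rw [(hg u hu).2 w hw, (hf _ (hg u hu).1).2 w hw]
  add_mem' := by
    intro f g hf hg u hu
    refine ⟨add_mem (hf u hu).1 (hg u hu).1, fun w hw => ?_⟩
    simp [(hf u hu).2 w hw, (hg u hu).2 w hw, add_mul]
  algebraMap_mem' := by
    intro c u hu
    refine ⟨?_, fun w hw => ?_⟩
    · rw [Module.algebraMap_end_apply]
      exact Subalgebra.smul_mem _ hu c
    · simp [Module.algebraMap_end_apply]

theorem creation_mem_leadingOperators (i : ι) : creation i ∈ leadingOperators i :=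
  fun _ hu => ⟨mul_mem ⟨FreeAlgebra.ι ℂ (), by simp⟩ hu, fun w _ => by simp [mul_assoc]⟩

theorem toeplitz_mem_leadingOperators (i : ι) (κ : ℕ → ℂ) :
    toeplitz i κ ∈ leadingOperators i := by
  rintro _ ⟨f, rfl⟩
  have hs := lift_toeplitz i _ (fun κ v => toeplitz_ι_mul_self i κ v)
  refine ⟨⟨toeplitz () κ f, hs κ f⟩, fun w hw => ?_⟩
  change toeplitz i κ (FreeAlgebra.lift ℂ _ f * w) = toeplitz i κ (FreeAlgebra.lift ℂ _ f) * w
  induction f using freeAlgebra_induction_left generalizing κ with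
  | one => simp [hw κ]
  | add f g hf hg => simp only [map_add, add_mul, hf, hg]
  | smul c f hf => simp only [map_smul, smul_mul_assoc, hf]
  | mul a f hf => simp [mul_assoc, hf, add_mul]

/-- Such an operator acts on `w` as on the vacuum with `w` appended; `f 1` splits into its vacuum
part and words starting with `i`. -/
theorem leadingOperators_apply {i : ι} {f : Module.End ℂ (FreeAlgebra ℂ ι)}
    (hf : f ∈ leadingOperators i) {w : FreeAlgebra ℂ ι} (hw : NotStartingWith i w) :
    ∃ r, f w = vacuum ι (f 1) • w + FreeAlgebra.ι ℂ i * r := by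
  obtain ⟨h1, h2⟩ := hf 1 (one_mem _)
  obtain ⟨r, hr⟩ := exists_eq_vacuum_add h1
  refine ⟨r * w, ?_⟩
  have h := h2 w hw
  rw [one_mul] at h
  rw [h]
  conv_lhs => rw [hr]
  rw [add_mul, smul_one_mul, mul_assoc]

variable (κ : ι → ℕ → ℂ)

theorem mem_leadingOperators_of_mem_adjoin {i : ι} {κ : ℕ → ℂ}
    {x : DualNumber (Module.End ℂ (FreeAlgebra ℂ ι))}
    (hx : x ∈ Algebra.adjoin ℂ {fockVariable i κ}) :
    x.fst ∈ leadingOperators i ∧ x.snd ∈ leadingOperators i := by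
  induction hx using Algebra.adjoin_induction with
  | mem x hx =>
    rw [Set.mem_singleton_iff.1 hx, fst_fockVariable, snd_fockVariable]
    exact ⟨add_mem (creation_mem_leadingOperators i) (toeplitz_mem_leadingOperators i κ),
      neg_mem (creation_mem_leadingOperators i)⟩
  | algebraMap c => exact ⟨Subalgebra.algebraMap_mem _ c, zero_mem _⟩
  | add x y _ _ hx hy => exact ⟨add_mem hx.1 hy.1, add_mem hx.2 hy.2⟩
  | mul x y _ _ hx hy =>
    rw [TrivSqZeroExt.fst_mul, TrivSqZeroExt.snd_mul]
    exact ⟨mul_mem hx.1 hy.1, add_mem (mul_mem hx.1 hy.2) (mul_mem hx.2 hy.1)⟩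

/-- The subalgebras generated by the variables on the Fock space. -/
noncomputable def fockSubalgebra (i : ι) :
    Subalgebra ℂ (DualNumber (Module.End ℂ (FreeAlgebra ℂ ι))) :=
  Algebra.adjoin ℂ {fockVariable i (κ i)}

theorem CenteredIn.apply_fst {κ : ι → ℕ → ℂ} {n : ℕ} {i : ℕ → ι}
    {b : ℕ → DualNumber (Module.End ℂ (FreeAlgebra ℂ ι))}
    (hb : CenteredIn (vacuumState ι) (fockSubalgebra κ) n i b) {k : ℕ} (hk : k < n)
    {w : FreeAlgebra ℂ ι} (hw : NotStartingWith (i k) w) :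
    ∃ r, (b k).fst w = FreeAlgebra.ι ℂ (i k) * r := by
  obtain ⟨r, hr⟩ :=
    leadingOperators_apply (mem_leadingOperators_of_mem_adjoin (hb k hk).1).1 hw
  have h0 := (hb k hk).2
  rw [vacuumState_apply] at h0
  exact ⟨r, by rw [hr, h0, zero_smul, zero_add]⟩

/-- Read from the right, each centered factor meets words starting with a different letter and
prepends its own, so the empty word is never reached. -/
theorem vacuum_orderedProd_ι_mul {n : ℕ} {i : ℕ → ι}
    {b : ℕ → DualNumber (Module.End ℂ (FreeAlgebra ℂ ι))} (hi : Alternating n i)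
    (hb : CenteredIn (vacuumState ι) (fockSubalgebra κ) n i b) (j : ι)
    (hj : ∀ k, n = k + 1 → i k ≠ j) (r : FreeAlgebra ℂ ι) :
    vacuum ι ((orderedProd n b).fst (FreeAlgebra.ι ℂ j * r)) = 0 := by
  induction n generalizing j r with
  | zero => simp
  | succ n ih =>
    obtain ⟨r', hr'⟩ := hb.apply_fst (Nat.lt_succ_self n)
      (notStartingWith_ι_mul (hj n rfl).symm r)
    rw [orderedProd_succ, TrivSqZeroExt.fst_mul, Module.End.mul_apply, hr']
    refine ih (fun k hk => hi k (by omega)) (fun k hk => hb k (by omega)) _ ?_ r'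
    rintro k rfl
    exact hi k (by omega)

theorem freelyIndependent_fockSubalgebra :
    FreelyIndependent (vacuumState ι) (fockSubalgebra κ) := by
  intro n i b hn hi hb
  obtain ⟨n, rfl⟩ := Nat.exists_eq_succ_of_ne_zero hn.ne'
  obtain ⟨r, hr⟩ := hb.apply_fst (Nat.lt_succ_self n) (notStartingWith_one (i n))
  rw [vacuumState_apply, orderedProd_succ, TrivSqZeroExt.fst_mul, Module.End.mul_apply, hr]
  refine vacuum_orderedProd_ι_mul κ (fun k hk => hi k (by omega))
    (fun k hk => hb k (by omega)) _ ?_ r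
  rintro k rfl
  exact hi k (by omega)

/-- A Leibniz rule: the perturbed factor acts as the scalar `vacuumState' ι (b k)` plus words
starting with its letter, and the latter are killed by the factors to its left. General `w` is
needed since stripping the last factor changes the vector. -/
theorem vacuum_orderedProd_snd {n : ℕ} {i : ℕ → ι}
    {b : ℕ → DualNumber (Module.End ℂ (FreeAlgebra ℂ ι))} (hi : Alternating n i)
    (hb : CenteredIn (vacuumState ι) (fockSubalgebra κ) n i b) (w : FreeAlgebra ℂ ι)
    (hw : ∀ k, n = k + 1 → NotStartingWith (i k) w) :
    vacuum ι ((orderedProd n b).snd w) = ∑ k ∈ range n, vacuumState' ι (b k) *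
      vacuum ι ((orderedProd k b * orderedProd (n - 1 - k) fun l => b (k + 1 + l)).fst w) := by
  induction n generalizing w with
  | zero => simp
  | succ n ih =>
    have hi' : Alternating n i := fun k hk => hi k (by omega)
    have hb' : CenteredIn (vacuumState ι) (fockSubalgebra κ) n i b := fun k hk => hb k (by omega)
    have hne : ∀ k, n = k + 1 → i k ≠ i n := by
      rintro k rfl
      exact hi k (by omega)
    obtain ⟨r, hr⟩ := hb.apply_fst (Nat.lt_succ_self n) (hw n rfl)
    obtain ⟨r', hr'⟩ := leadingOperators_apply
      (mem_leadingOperators_of_mem_adjoin (hb n (Nat.lt_succ_self n)).1).2 (hw n rfl)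
    have hsnd : (orderedProd (n + 1) b).snd w =
        (orderedProd n b).fst ((b n).snd w) + (orderedProd n b).snd ((b n).fst w) := by
      rw [orderedProd_succ, TrivSqZeroExt.snd_mul]
      rfl
    rw [hsnd, map_add, sum_range_succ, add_comm]
    congr 1
    · rw [ih hi' hb' _ fun k hk => hr ▸ notStartingWith_ι_mul (hne k hk).symm r]
      refine sum_congr rfl fun k hk => ?_
      have hk := mem_range.1 hk
      rw [show n + 1 - 1 - k = n - 1 - k + 1 by omega, orderedProd_succ, ← mul_assoc,
        TrivSqZeroExt.fst_mul _ (b _), Module.End.mul_apply,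
        show k + 1 + (n - 1 - k) = n by omega]
    · rw [hr', map_add, map_add, vacuum_orderedProd_ι_mul κ hi' hb' _ hne, add_zero, map_smul,
        map_smul, ← vacuumState'_apply]
      simp

theorem infinitesimallyFree_fockSubalgebra :
    InfinitesimallyFree (vacuumState ι) (vacuumState' ι) (fockSubalgebra κ) :=
  (freelyIndependent_fockSubalgebra κ).infinitesimallyFree (by simp [vacuumState_apply]) _
    fun _ _ _ hi hb => vacuum_orderedProd_snd κ hi hb 1 fun _ _ => notStartingWith_one _

end FockFreeness

/-! ### Freeness determines the law of the sum -/

section Uniqueness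

variable {ι : Type*}

/-- The span of the alternating products of polynomials in the letters of the free algebra which
are centered with respect to the distributions `μ`. -/
noncomputable def centeredSpan (μ : ι → Distribution) : Submodule ℂ (FreeAlgebra ℂ ι) :=
  Submodule.span ℂ {a | ∃ (n : ℕ) (i : ℕ → ι) (p : ℕ → Polynomial ℂ), Alternating n i ∧
    (∀ k < n, μ (i k) (p k) = 0) ∧
    a = orderedProd n fun k => Polynomial.aeval (FreeAlgebra.ι ℂ (i k)) (p k)}

variable {μ : ι → Distribution}

theorem orderedProd_mul_aeval_mem_centeredSpan (hμ : ∀ i, μ i 1 = 1) {n : ℕ} {i : ℕ → ι}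
    {p : ℕ → Polynomial ℂ} (hi : Alternating n i) (hp : ∀ k < n, μ (i k) (p k) = 0) (j : ι)
    (hj : ∀ k, n = k + 1 → i k ≠ j) (q : Polynomial ℂ) :
    (orderedProd n fun k => Polynomial.aeval (FreeAlgebra.ι ℂ (i k)) (p k)) *
      Polynomial.aeval (FreeAlgebra.ι ℂ j) q ∈ centeredSpan μ := by
  classical
  have hq : q = (q - μ j q • 1) + μ j q • 1 := by simp
  rw [hq, map_add, mul_add]
  refine add_mem ?_ ?_
  · refine Submodule.subset_span ⟨n + 1, Function.update i n j,
      Function.update p n (q - μ j q • 1), fun k hk => ?_, fun k hk => ?_, ?_⟩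
    · rw [Function.update_of_ne (by omega)]
      rcases Nat.lt_succ_iff_lt_or_eq.1 hk with hk | hk
      · rw [Function.update_of_ne (by omega)]
        exact hi k hk
      · rw [hk, Function.update_self]
        exact hj k hk.symm
    · rcases Nat.lt_succ_iff_lt_or_eq.1 hk with hk | rfl
      · rw [Function.update_of_ne (by omega), Function.update_of_ne (by omega)]
        exact hp k hk
      · simp [hμ]
    · rw [orderedProd_succ, Function.update_self, Function.update_self]
      congr 1
      refine orderedProd_congr fun k hk => ?_
      rw [Function.update_of_ne (by omega), Function.update_of_ne (by omega)]
  · rw [map_smul, map_one, mul_smul_comm, mul_one]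
    exact Submodule.smul_mem _ _ (Submodule.subset_span ⟨n, i, p, hi, hp, rfl⟩)

theorem mul_ι_mem_centeredSpan (hμ : ∀ i, μ i 1 = 1) {a : FreeAlgebra ℂ ι}
    (ha : a ∈ centeredSpan μ) (j : ι) : a * FreeAlgebra.ι ℂ j ∈ centeredSpan μ := by
  induction ha using Submodule.span_induction with
  | zero => simp
  | add x y _ _ hx hy => rw [add_mul]; exact add_mem hx hy
  | smul c x _ hx => rw [smul_mul_assoc]; exact Submodule.smul_mem _ c hx
  | mem x hx =>
    obtain ⟨n, i, p, hi, hp, rfl⟩ := hx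
    by_cases hj : ∀ k, n = k + 1 → i k ≠ j
    · simpa using orderedProd_mul_aeval_mem_centeredSpan hμ hi hp j hj Polynomial.X
    · push Not at hj
      -- The letter merges into the last factor, which loses its centering; hence the previous lemma
      -- allows arbitrary `q`.
      obtain ⟨n, rfl, rfl⟩ := hj
      have := orderedProd_mul_aeval_mem_centeredSpan hμ (n := n) (fun k hk => hi k (by omega))
        (fun k hk => hp k (by omega)) (i n) (by rintro k rfl; exact hi k (by omega))
        (p n * Polynomial.X)
      rwa [map_mul, Polynomial.aeval_X, ← mul_assoc, ← orderedProd_succ n fun k =>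
        Polynomial.aeval (FreeAlgebra.ι ℂ (i k)) (p k)] at this

theorem add_pow_mem_centeredSpan (hμ : ∀ i, μ i 1 = 1) (j j' : ι) (n : ℕ) :
    (FreeAlgebra.ι ℂ j + FreeAlgebra.ι ℂ j') ^ n ∈ centeredSpan μ := by
  induction n with
  | zero =>
    exact Submodule.subset_span ⟨0, fun _ => j, 0, fun _ h => absurd h (by omega),
      fun _ h => absurd h (by omega), by simp⟩
  | succ n ih =>
    rw [pow_succ, mul_add]
    exact add_mem (mul_ι_mem_centeredSpan hμ ih j) (mul_ι_mem_centeredSpan hμ ih j')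

variable {B C : Type*} [Ring B] [Algebra ℂ B] [Ring C] [Algebra ℂ C]

theorem lift_orderedProd_aeval (b : ι → B) (n : ℕ) (i : ℕ → ι) (p : ℕ → Polynomial ℂ) :
    FreeAlgebra.lift ℂ b
        (orderedProd n fun k => Polynomial.aeval (FreeAlgebra.ι ℂ (i k)) (p k)) =
      orderedProd n fun k => Polynomial.aeval (b (i k)) (p k) := by
  simp [orderedProd, map_list_prod, Function.comp_def, ← Polynomial.aeval_algHom_apply]

theorem distribution_add_eq (hμ : ∀ i, μ i 1 = 1) {φ : B →ₗ[ℂ] ℂ} {ψ : C →ₗ[ℂ] ℂ} {b : ι → B}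
    {c : ι → C}
    (h : ∀ (n : ℕ) (i : ℕ → ι) (p : ℕ → Polynomial ℂ), Alternating n i →
      (∀ k < n, μ (i k) (p k) = 0) →
      φ (orderedProd n fun k => Polynomial.aeval (b (i k)) (p k)) =
        ψ (orderedProd n fun k => Polynomial.aeval (c (i k)) (p k))) (j j' : ι) :
    distribution φ (b j + b j') = distribution ψ (c j + c j') := by
  refine distribution_ext fun n => ?_
  rw [distribution_X_pow, distribution_X_pow]
  have key : Set.EqOn (φ ∘ₗ (FreeAlgebra.lift ℂ b).toLinearMap)
      (ψ ∘ₗ (FreeAlgebra.lift ℂ c).toLinearMap) (centeredSpan μ) := by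
    refine LinearMap.eqOn_span ?_
    rintro _ ⟨n, i, p, hi, hp, rfl⟩
    simpa [lift_orderedProd_aeval] using h n i p hi hp
  simpa using key (add_pow_mem_centeredSpan hμ j j' n)

theorem centeredIn_aeval {φ : B →ₗ[ℂ] ℂ} {b : ι → B} (hb : ∀ i, distribution φ (b i) = μ i)
    {n : ℕ} {i : ℕ → ι} {p : ℕ → Polynomial ℂ} (hp : ∀ k < n, μ (i k) (p k) = 0) :
    CenteredIn φ (fun i => Algebra.adjoin ℂ {b i}) n i
      fun k => Polynomial.aeval (b (i k)) (p k) :=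
  fun k hk => ⟨Polynomial.aeval_mem_adjoin_singleton ℂ _, by rw [← hp k hk, ← hb]; rfl⟩

theorem FreelyIndependent.distribution_add_unique {φ : B →ₗ[ℂ] ℂ} {ψ : C →ₗ[ℂ] ℂ} {b : ι → B}
    {c : ι → C} (hφ : φ 1 = 1) (hψ : ψ 1 = 1)
    (hb : FreelyIndependent φ fun i => Algebra.adjoin ℂ {b i})
    (hc : FreelyIndependent ψ fun i => Algebra.adjoin ℂ {c i})
    (h : ∀ i, distribution φ (b i) = distribution ψ (c i)) (j j' : ι) :
    distribution φ (b j + b j') = distribution ψ (c j + c j') := by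
  refine distribution_add_eq (μ := fun i => distribution ψ (c i))
    (fun i => by simp [distribution, hψ]) (fun n i p hi hp => ?_) j j'
  rcases Nat.eq_zero_or_pos n with rfl | hn
  · simp [hφ, hψ]
  · rw [hb n i _ hn hi (centeredIn_aeval h hp), hc n i _ hn hi (centeredIn_aeval (fun _ => rfl) hp)]

theorem InfinitesimallyFree.distribution_add_unique {φ φ' : B →ₗ[ℂ] ℂ} {ψ ψ' : C →ₗ[ℂ] ℂ}
    {b : ι → B} {c : ι → C} (hψ : ψ 1 = 1) (hφ' : φ' 1 = 0) (hψ' : ψ' 1 = 0)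
    (hb : InfinitesimallyFree φ φ' fun i => Algebra.adjoin ℂ {b i})
    (hc : InfinitesimallyFree ψ ψ' fun i => Algebra.adjoin ℂ {c i})
    (h : ∀ i, distribution φ (b i) = distribution ψ (c i))
    (h' : ∀ i, distribution φ' (b i) = distribution ψ' (c i)) (j j' : ι) :
    distribution φ' (b j + b j') = distribution ψ' (c j + c j') := by
  refine distribution_add_eq (μ := fun i => distribution ψ (c i))
    (fun i => by simp [distribution, hψ]) (fun n i p hi hp => ?_) j j'
  rcases Nat.eq_zero_or_pos n with rfl | hn
  · simp [hφ', hψ']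
  · rw [(hb n i _ hn hi (centeredIn_aeval h hp)).2,
      (hc n i _ hn hi (centeredIn_aeval (fun _ => rfl) hp)).2]
    split_ifs with hpal
    · congr 1
      · refine prod_congr rfl fun k hk => ?_
        -- By the palindrome condition both factors are polynomials in the same variable, so the
        -- given distributions determine the value.
        rw [← hpal.2 k (mem_range.1 hk), ← map_mul, ← map_mul]
        exact LinearMap.congr_fun (h (i k)) _
      · exact LinearMap.congr_fun (h' _) _
    · rfl

end Uniqueness

/-! ### Existence and uniqueness of the convolutions -/

section Convolution

theorem pair_adjoin_eq {B : Type*} [Ring B] [Algebra ℂ B] (b₁ b₂ : B) :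
    ![Algebra.adjoin ℂ {b₁}, Algebra.adjoin ℂ {b₂}] =
      fun i : Fin 2 => Algebra.adjoin ℂ {(![b₁, b₂] : Fin 2 → B) i} := by
  ext1 i
  fin_cases i <;> rfl

theorem IsFreeConvolution.unique {μ₁ μ₂ μ ν : Distribution}
    (h : IsFreeConvolution.{u} μ₁ μ₂ μ) (h' : IsFreeConvolution.{u} μ₁ μ₂ ν) : μ = ν := by
  obtain ⟨B, _, _, φ, b₁, b₂, h1, hf, hb₁, hb₂, rfl⟩ := h
  obtain ⟨C, _, _, ψ, c₁, c₂, h1', hf', hc₁, hc₂, rfl⟩ := h'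
  rw [pair_adjoin_eq] at hf hf'
  refine hf.distribution_add_unique h1 h1' hf' (fun i => ?_) 0 1
  fin_cases i
  exacts [hb₁.trans hc₁.symm, hb₂.trans hc₂.symm]

theorem IsInfinitesimalFreeConvolution.unique {p₁ p₂ p q : Distribution × Distribution}
    (h : IsInfinitesimalFreeConvolution.{u} p₁ p₂ p)
    (h' : IsInfinitesimalFreeConvolution.{u} p₁ p₂ q) : p = q := by
  obtain ⟨B, _, _, φ, φ', b₁, b₂, h1, h0, hf, hb₁, hb₂, rfl⟩ := h
  obtain ⟨C, _, _, ψ, ψ', c₁, c₂, h1', h0', hf', rfl, rfl, rfl⟩ := h'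
  rw [pair_adjoin_eq] at hf hf'
  rw [Prod.mk.injEq] at hb₁ hb₂
  have e : ∀ i : Fin 2, distribution φ ((![b₁, b₂] : Fin 2 → B) i) =
      distribution ψ ((![c₁, c₂] : Fin 2 → C) i) := by
    intro i
    fin_cases i
    exacts [hb₁.1, hb₂.1]
  have e' : ∀ i : Fin 2, distribution φ' ((![b₁, b₂] : Fin 2 → B) i) =
      distribution ψ' ((![c₁, c₂] : Fin 2 → C) i) := by
    intro i
    fin_cases i
    exacts [hb₁.2, hb₂.2]
  rw [Prod.mk.injEq]
  exact ⟨hf.freelyIndependent.distribution_add_unique h1 h1' hf'.freelyIndependent e 0 1,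
    hf.distribution_add_unique h1' h0 h0' hf' e e' 0 1⟩

theorem IsInfinitesimalFreeConvolution.isFreeConvolution {p₁ p₂ p : Distribution × Distribution}
    (h : IsInfinitesimalFreeConvolution.{u} p₁ p₂ p) :
    IsFreeConvolution.{u} p₁.1 p₂.1 p.1 := by
  obtain ⟨B, _, _, φ, φ', b₁, b₂, h1, -, hf, rfl, rfl, rfl⟩ := h
  exact ⟨B, _, _, φ, b₁, b₂, h1, hf.freelyIndependent, rfl, rfl, rfl⟩

/-- The infinitesimal distributions of the variables on the Fock space add up under infinitesimal
free convolution. -/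
theorem isInfinitesimalFreeConvolution_fockVariable (κ₁ κ₂ : ℕ → ℂ) :
    IsInfinitesimalFreeConvolution.{u}
      (distribution (vacuumState Unit) (fockVariable () κ₁),
        distribution (vacuumState' Unit) (fockVariable () κ₁))
      (distribution (vacuumState Unit) (fockVariable () κ₂),
        distribution (vacuumState' Unit) (fockVariable () κ₂))
      (distribution (vacuumState Unit) (fockVariable () (κ₁ + κ₂)),
        distribution (vacuumState' Unit) (fockVariable () (κ₁ + κ₂))) := by
  -- Lifting the two-letter alphabet places the Fock space model in universe `u`.
  let ι := ULift.{u} (Fin 2)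
  refine ⟨DualNumber (Module.End ℂ (FreeAlgebra ℂ ι)), inferInstance, inferInstance,
    vacuumState ι, vacuumState' ι, fockVariable ⟨0⟩ κ₁, fockVariable ⟨1⟩ κ₂,
    by simp [vacuumState_apply], by simp [vacuumState'_apply], ?_, ?_, ?_, ?_⟩
  · have h := (infinitesimallyFree_fockSubalgebra fun i : ι => ![κ₁, κ₂] i.down).comp
      ULift.up_injective
    convert h using 1
    ext1 i
    fin_cases i <;> rfl
  · rw [(distribution_fockVariable _ κ₁).1, (distribution_fockVariable _ κ₁).2]
  · rw [(distribution_fockVariable _ κ₂).1, (distribution_fockVariable _ κ₂).2]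
  · have h := distribution_fockVariable_add (i := (⟨0⟩ : ι)) (j := ⟨1⟩)
      (by simp [ULift.ext_iff]) κ₁ κ₂
    rw [h.1, h.2]

theorem IsInverseMarkovKrein.eq_sub {κ : ℕ → ℂ} {τ : Distribution}
    (h : IsInverseMarkovKrein (distribution (vacuumState Unit) (fockVariable () κ)) τ) :
    distribution (vacuumState' Unit) (fockVariable () κ) =
      distribution (vacuumState Unit) (fockVariable () κ) - τ := by
  rw [(existsUnique_isInverseMarkovKrein _ (by simp [distribution, vacuumState_apply])).unique h
    (isInverseMarkovKrein_fockVariable κ), sub_sub_cancel]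

end Convolution

end FreeProb

theorem proposition5p5 (μ₁ μ₂ τ₁ τ₂ : FreeProb.Distribution)
    (hμ₁ : μ₁ 1 = 1) (hμ₂ : μ₂ 1 = 1)
    (hτ₁ : FreeProb.IsInverseMarkovKrein μ₁ τ₁) (hτ₂ : FreeProb.IsInverseMarkovKrein μ₂ τ₂) :
    (∃! μ : FreeProb.Distribution, FreeProb.IsFreeConvolution.{u} μ₁ μ₂ μ) ∧
    ∀ μ τ : FreeProb.Distribution,
      FreeProb.IsFreeConvolution.{u} μ₁ μ₂ μ → FreeProb.IsInverseMarkovKrein μ τ →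
      ∀ p : FreeProb.Distribution × FreeProb.Distribution,
        FreeProb.IsInfinitesimalFreeConvolution.{u} (μ₁, μ₁ - τ₁) (μ₂, μ₂ - τ₂) p ↔
          p = (μ, μ - τ) := by
  obtain ⟨κ₁, rfl⟩ := FreeProb.exists_distribution_fockVariable_eq μ₁ hμ₁
  obtain ⟨κ₂, rfl⟩ := FreeProb.exists_distribution_fockVariable_eq μ₂ hμ₂
  have key := FreeProb.isInfinitesimalFreeConvolution_fockVariable.{u} κ₁ κ₂
  refine ⟨⟨_, key.isFreeConvolution, fun μ hμ => hμ.unique key.isFreeConvolution⟩, ?_⟩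
  intro μ τ hμ hτ p
  -- Uniqueness identifies `μ` with the law of parameter `κ₁ + κ₂`, so `eq_sub` applies to all three
  -- laws.
  obtain rfl := key.isFreeConvolution.unique hμ
  rw [← hτ₁.eq_sub, ← hτ₂.eq_sub, ← hτ.eq_sub]
  exact ⟨fun hp => hp.unique key, fun hp => hp ▸ key⟩
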